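/- Let $V$ be an arbitrary set of propositional variables and $p\in V$. Consider the modal formulas built from the variables in $V$ by the Boolean connectives and modalities $[0],[1],[2],\dots$, and write $\langle n\rangle\varphi$ for $\neg[n]\neg\varphi$. The logic $\mathbf{GLP}$ is axiomatized by the classical propositional tautologies and the schemata $[n](\varphi\to\psi)\to([n]\varphi\to[n]\psi)$; $[n]([n]\varphi\to\varphi)\to[n]\varphi$; $\langle m\rangle\varphi\to[n]\langle m\rangle\varphi$ for $m<n$; $[m]\varphi\to[n]\varphi$ for $m\le n$; with the rules of modus ponens and necessitation ($\vdash\varphi\Rightarrow\;\vdash[n]\varphi$). A substitution is a map from formulas to formulas commuting with all connectives and modalities; it is a unifier of $\varphi$ in $\mathbf{GLP}$ if $\mathbf{GLP}\vdash\sigma(\varphi)$. For substitutions $\tau,\sigma$ write $\tau\le\sigma$ if there is a substitution $\theta$ such that $\mathbf{GLP}\vdash\tau(q)\leftrightarrow\theta(\sigma(q))$ for all variables $q\in V$. Let $Q_1:=p$, $Q_{i+1}:=p\lor[0]Q_i$ and $Q^k(p):=\bigwedge_{i=1}^k([0]Q_i\to Q_i)$ for $k\ge1$. Denote also by $Q^k$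 the substitution that maps $p$ to $Q^k(p)$ and fixes all other variables. A formula $\varphi$ follows from at most $k$ instances of reflection if $\mathbf{GLP}\vdash\bigwedge_{i=1}^{l}([0]\psi_i\to\psi_i)\to\varphi$ for some $l\le k$ and formulas $\psi_1,\dots,\psi_l$. Then: (1) A substitution $\sigma$ is a unifier of $[1]p$ in $\mathbf{GLP}$ if and only if $\sigma\le Q^k$ for some $k\ge1$. (2) For every $k\ge1$, $Q^k$ is a most general unifier of $[1]p$ among those that follow from at most $k$ instances of reflection: $Q^k$ is a unifier of $[1]p$, $Q^k(p)$ follows from at most $k$ instances of reflection, and $\sigma\le Q^k$ for every unifier $\sigma$ of $[1]p$ such that $\sigma(p)$ follows from at most $k$ instances of reflection. -/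

import Mathlib

/-- Formulas of the polymodal language with modalities `[0], [1], [2], …` and variables in `V`. -/
inductive Form (V : Type*) : Type _
  | var : V → Form V
  | bot : Form V
  | imp : Form V → Form V → Form V
  | box : ℕ → Form V → Form V

namespace Form

variable {V : Type*}

def neg (φ : Form V) : Form V := φ.imp bot

def top : Form V := neg bot

def or (φ ψ : Form V) : Form V := φ.neg.imp ψ

def and (φ ψ : Form V) : Form V := (φ.imp ψ.neg).neg

def iff (φ ψ : Form V) : Form V := (φ.imp ψ).and (ψ.imp φ)

/-- The dual modality `⟨n⟩φ`. -/
def dia (n : ℕ) (φ : Form V) : Form V := (box n φ.neg).neg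

/-- The conjunction of a finite list of formulas; the empty conjunction is `⊤`. -/
def conj : List (Form V) → Form V
  | [] => top
  | φ :: l => φ.and (conj l)

/-- Classical truth value of a formula, where `v` assigns truth values to the variables
and to the formulas beginning with a modality (which are treated as propositional atoms). -/
def eval (v : Form V → Prop) : Form V → Prop
  | var q => v (var q)
  | bot => False
  | imp φ ψ => eval v φ → eval v ψ
  | box n φ => v (box n φ)

/-- Tautologies of the classical propositional calculus, in the modal language. -/
def IsTautology (φ : Form V) : Prop := ∀ v : Form V → Prop, φ.eval v

/-- The result `σ(φ)` of applying a substitution, given by its values on the variables. -/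
def subst (σ : V → Form V) : Form V → Form V
  | var q => σ q
  | bot => bot
  | imp φ ψ => (subst σ φ).imp (subst σ ψ)
  | box n φ => box n (subst σ φ)

/-- The instance `[0]φ → φ` of reflection. -/
def reflection (φ : Form V) : Form V := (box 0 φ).imp φ

/-- `Q_1(φ) = φ`, `Q_{i+1}(φ) = φ ∨ [0]Q_i(φ)`. The index `0` is not used. -/
def Q (φ : Form V) : ℕ → Form V
  | 0 => φ
  | 1 => φ
  | i + 2 => φ.or (box 0 (Q φ (i + 1)))

/-- `Q^k(φ) = ⋀_{i=1}^k ([0]Q_i(φ) → Q_i(φ))`. -/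
def QConj (φ : Form V) (k : ℕ) : Form V :=
  conj ((List.range' 1 k).map fun i => reflection (Q φ i))

end Form

/-- Theorems of Japaridze's polymodal provability logic. -/
inductive GLP {V : Type*} : Form V → Prop
  | taut {φ : Form V} : φ.IsTautology → GLP φ
  | axK (n : ℕ) (φ ψ : Form V) :
      GLP ((Form.box n (φ.imp ψ)).imp ((Form.box n φ).imp (Form.box n ψ)))
  | loeb (n : ℕ) (φ : Form V) :
      GLP ((Form.box n ((Form.box n φ).imp φ)).imp (Form.box n φ))
  | negIntro {m n : ℕ} (φ : Form V) : m < n →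
      GLP ((Form.dia m φ).imp (Form.box n (Form.dia m φ)))
  | mono {m n : ℕ} (φ : Form V) : m ≤ n →
      GLP ((Form.box m φ).imp (Form.box n φ))
  | mp {φ ψ : Form V} : GLP (φ.imp ψ) → GLP φ → GLP ψ
  | nec (n : ℕ) {φ : Form V} : GLP φ → GLP (Form.box n φ)

/-- The substitution `σ` is a unifier of `φ` in the logic with set of theorems `L`. -/
def IsUnifier {V : Type*} (L : Form V → Prop) (σ : V → Form V) (φ : Form V) : Prop :=
  L (φ.subst σ)

/-- `τ ≤ σ`, that is, `τ = θσ` in `L` for some substitution `θ`. -/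
def LessGeneral {V : Type*} (L : Form V → Prop) (τ σ : V → Form V) : Prop :=
  ∃ θ : V → Form V, ∀ q : V, L ((τ q).iff ((σ q).subst θ))

/-- `σ` is a most general element of the set `S` of substitutions. -/
def IsMostGeneral {V : Type*} (L : Form V → Prop) (S : Set (V → Form V)) (σ : V → Form V) :
    Prop :=
  σ ∈ S ∧ ∀ τ ∈ S, LessGeneral L τ σ

/-- `φ` follows in `L` from at most `k` instances of reflection, that is,
`L ⊢ ⋀_{i=1}^l ([0]ψ_i → ψ_i) → φ` for some `ψ_1, …, ψ_l` with `l ≤ k`. -/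
def FollowsFromReflections {V : Type*} (L : Form V → Prop) (k : ℕ) (φ : Form V) : Prop :=
  ∃ l : List (Form V), l.length ≤ k ∧ L ((Form.conj (l.map Form.reflection)).imp φ)

/-- The substitution `p ↦ Q^k(p)`, which fixes all variables other than `p`. -/
def QSubst {V : Type*} [DecidableEq V] (p : V) (k : ℕ) : V → Form V :=
  Function.update Form.var p (Form.QConj (Form.var p) k)

/-! `[1]φ` is provable exactly when `φ` follows from finitely many instances of reflection: `[1]`
proves each instance (`box_one_reflection`), and a world satisfying all instances but not `φ` has a
new world placed below it, where `[1]φ` fails (`truthBelow_of_GLP`). If `k` instances suffice, a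
world refuting `φ` refutes some `[0]ψ → ψ`, hence satisfies `[0]ψ`, and that instance is spent at
all later worlds. So no `[0]`-chain of `k + 1` worlds refutes `φ`, which is what `Q φ (k + 1)`
expresses. Hence `φ` is equivalent to `QConj φ k` (`iff_QConj_of_followsFromReflections`), and a
unifier factors through `QSubst p k` via itself. -/

namespace Form

variable {V : Type*}

/-! ### Classical truth, substitution and compactness -/

theorem eval_neg (v : Form V → Prop) (φ : Form V) : φ.neg.eval v ↔ ¬ φ.eval v := Iff.rfl

theorem eval_imp (v : Form V → Prop) (φ ψ : Form V) :
    (φ.imp ψ).eval v ↔ (φ.eval v → ψ.eval v) := Iff.rfl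

theorem eval_or (v : Form V → Prop) (φ ψ : Form V) :
    (φ.or ψ).eval v ↔ φ.eval v ∨ ψ.eval v := by
  simp only [Form.or, eval_imp, eval_neg]
  tauto

theorem eval_and (v : Form V → Prop) (φ ψ : Form V) :
    (φ.and ψ).eval v ↔ φ.eval v ∧ ψ.eval v := by
  simp only [Form.and, eval_imp, eval_neg]
  tauto

theorem eval_iff (v : Form V → Prop) (φ ψ : Form V) :
    (φ.iff ψ).eval v ↔ (φ.eval v ↔ ψ.eval v) := by
  simp only [Form.iff, eval_imp, eval_and]
  tauto

theorem eval_conj (v : Form V → Prop) (l : List (Form V)) :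
    (conj l).eval v ↔ ∀ φ ∈ l, φ.eval v := by
  induction l with
  | nil => simp [conj, top, eval_neg, eval]
  | cons φ l ih => simp [conj, eval_and, ih]

theorem eval_reflection (v : Form V → Prop) (φ : Form V) :
    (reflection φ).eval v ↔ ((box 0 φ).eval v → φ.eval v) := Iff.rfl

theorem subst_conj (σ : V → Form V) (l : List (Form V)) :
    (conj l).subst σ = conj (l.map (subst σ)) := by
  induction l with
  | nil => rfl
  | cons φ l ih => simp [conj, Form.and, neg, subst, ih]

theorem subst_Q (σ : V → Form V) (φ : Form V) : ∀ i, (Q φ i).subst σ = Q (φ.subst σ) i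
  | 0 => rfl
  | 1 => rfl
  | i + 2 => by simp [Q, Form.or, neg, subst, subst_Q σ φ (i + 1)]

theorem subst_QConj (σ : V → Form V) (φ : Form V) (k : ℕ) :
    (QConj φ k).subst σ = QConj (φ.subst σ) k := by
  simp [QConj, subst_conj, Function.comp_def, reflection, subst, subst_Q]

/-- Compactness of classical propositional logic. -/
theorem exists_eval_of_finset (T : Set (Form V))
    (h : ∀ F : Finset (Form V), ↑F ⊆ T → ∃ v : Form V → Prop, ∀ φ ∈ F, φ.eval v) :
    ∃ v : Form V → Prop, ∀ φ ∈ T, φ.eval v := by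
  classical
  choose w hw using fun F : Finset T =>
    h (F.map (Function.Embedding.subtype _)) (by intro φ; simp; tauto)
  -- The limit of the valuations `w F` along an ultrafilter finer than `atTop`; each formula of `T`
  -- holds in `w F` for all large `F`.
  let U : Ultrafilter (Finset T) := Ultrafilter.of Filter.atTop
  have key : ∀ φ : Form V,
      φ.eval (fun χ => ∀ᶠ F in (U : Filter (Finset T)), χ.eval (w F)) ↔
        ∀ᶠ F in (U : Filter (Finset T)), φ.eval (w F) := by
    intro φ
    induction φ with
    | var q => exact Iff.rfl
    | bot => simp [eval, U.neBot.ne]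
    | imp φ ψ hφ hψ => simp only [eval_imp, hφ, hψ, Ultrafilter.eventually_imp]
    | box n φ _ => exact Iff.rfl
  refine ⟨_, fun φ hφ => (key φ).2 ?_⟩
  refine (Ultrafilter.of_le Filter.atTop) ?_
  filter_upwards [Filter.eventually_ge_atTop ({⟨φ, hφ⟩} : Finset T)] with F hF
  exact hw F φ (by simpa using ⟨hφ, Finset.singleton_subset_iff.1 hF⟩)

/-- A set of formulas that contains the tautologies and is closed under modus ponens is the
intersection of the complete theories that extend it. -/
theorem exists_eval_not_of_not_mem {D : Form V → Prop} (taut : ∀ φ, IsTautology φ → D φ)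
    (mp : ∀ φ ψ, D (φ.imp ψ) → D φ → D ψ) {φ : Form V} (hφ : ¬ D φ) :
    ∃ v : Form V → Prop, (∀ χ, D χ → χ.eval v) ∧ ¬ φ.eval v := by
  classical
  have detach : ∀ (l : List (Form V)) (ψ : Form V), (∀ χ ∈ l, D χ ∨ χ = φ.neg) →
      (∀ v : Form V → Prop, (∀ χ ∈ l, χ.eval v) → ψ.eval v) → D (φ.neg.imp ψ) := by
    intro l
    induction l with
    | nil =>
      intro ψ _ h
      exact taut _ fun v _ => h v (by simp)
    | cons χ l ih =>
      intro ψ hl h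
      have h' := ih (χ.imp ψ) (fun x hx => hl x (by simp [hx]))
        (fun v hv hχ => h v (by simpa using ⟨hχ, hv⟩))
      rcases hl χ (by simp) with hχ | rfl
      · refine mp _ _ (mp _ _ (taut _ fun v => ?_) h') hχ
        simp only [eval_imp]
        tauto
      · refine mp _ _ (taut _ fun v => ?_) h'
        simp only [eval_imp]
        tauto
  obtain ⟨v, hv⟩ := exists_eval_of_finset {χ | D χ ∨ χ = φ.neg} (by
    intro F hF
    by_contra! hcon
    have := detach F.toList bot (fun χ hχ => hF (by simpa using hχ)) (fun v hv => by
      obtain ⟨χ, hχ, hn⟩ := hcon v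
      exact hn (hv χ (by simpa using hχ)))
    refine hφ (mp _ _ (taut _ fun v => ?_) this)
    simp only [eval_neg, eval]
    tauto)
  exact ⟨v, fun χ hχ => hv χ (Or.inl hχ), hv φ.neg (Or.inr rfl)⟩

end Form

/-! ### Reasoning in GLP through worlds -/

namespace GLP

open Form

variable {V : Type*}

/-- A valuation that makes all theorems of `GLP` true. -/
def World (v : Form V → Prop) : Prop := ∀ φ, GLP φ → φ.eval v

theorem of_world {φ : Form V} (h : ∀ v, World v → φ.eval v) : GLP φ := by
  by_contra hφ
  obtain ⟨v, hv, hn⟩ := exists_eval_not_of_not_mem (D := GLP) (fun _ => taut)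
    (fun _ _ => mp) hφ
  exact hn (h v hv)

theorem World.box_mono {v : Form V → Prop} (hv : World v) {n : ℕ} {φ ψ : Form V}
    (h : ∀ w, World w → φ.eval w → ψ.eval w) (hφ : (box n φ).eval v) : (box n ψ).eval v :=
  hv _ (axK n φ ψ) (hv _ (nec n (of_world (φ := φ.imp ψ) h)) ) hφ

theorem World.box_and {v : Form V → Prop} (hv : World v) {n : ℕ} {φ ψ : Form V}
    (hφ : (box n φ).eval v) (hψ : (box n ψ).eval v) : (box n (φ.and ψ)).eval v := by
  refine hv _ (axK n ψ (φ.and ψ)) (hv.box_mono (fun w _ h => ?_) hφ) hψ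
  simp only [eval_imp, eval_and]
  tauto

theorem box_trans (n : ℕ) (φ : Form V) : GLP ((box n φ).imp (box n (box n φ))) := by
  refine of_world fun v hv hφ => ?_
  -- Löb's axiom is applied to `φ ∧ [n]φ`.
  have h : (box n (φ.and (box n φ))).eval v := by
    refine hv _ (loeb n _) (hv.box_mono (fun w hw h => ?_) hφ)
    intro h'
    exact (eval_and _ _ _).2 ⟨h, hw.box_mono (fun u _ hu => ((eval_and _ _ _).1 hu).1) h'⟩
  exact hv.box_mono (fun u _ hu => ((eval_and _ _ _).1 hu).2) h

/-- Either `[0]φ` holds and monotonicity gives `[1]φ`, or `⟨0⟩¬φ` holds and `negIntro` puts it under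
`[1]`, where it refutes the premise `[0]φ`. -/
theorem box_one_reflection (φ : Form V) : GLP (box 1 (reflection φ)) := by
  refine of_world fun v hv => ?_
  by_cases h : (box 0 φ).eval v
  · exact hv.box_mono (fun w _ hw _ => hw) (hv _ (mono (m := 0) φ (Nat.zero_le 1)) h)
  · have hd : (dia 0 φ.neg).eval v := fun h' =>
      h (hv.box_mono (φ := φ.neg.neg) (fun w _ hw => not_not.1 (show ¬¬ φ.eval w from hw)) h')
    refine hv.box_mono (fun w hw hwd hb => ?_) (hv _ (negIntro φ.neg zero_lt_one) hd)
    exact (hwd (hw.box_mono (fun u _ hu => not_not.2 hu) hb)).elim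

theorem box_conj (n : ℕ) (l : List (Form V)) (h : ∀ φ ∈ l, GLP (box n φ)) :
    GLP (box n (conj l)) := by
  induction l with
  | nil => exact nec n (taut fun v h => h)
  | cons φ l ih =>
    exact of_world fun v hv => hv.box_and (hv _ (h φ (by simp)))
      (hv _ (ih fun ψ hψ => h ψ (by simp [hψ])))

theorem box_one_QConj (φ : Form V) (k : ℕ) : GLP (box 1 (QConj φ k)) := by
  refine box_conj 1 _ fun ψ hψ => ?_
  obtain ⟨i, -, rfl⟩ := List.mem_map.1 hψ
  exact box_one_reflection _

/-- Truth at a new world, whose only `[1]`-successors are the world `u` and those of `u`, which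
sees at `[0]` what `u` sees, and which has no `[n]`-successors for `2 ≤ n`. -/
def truthBelow (u : Form V → Prop) : Form V → Prop
  | var _ => False
  | bot => False
  | imp φ ψ => truthBelow u φ → truthBelow u ψ
  | box 0 φ => (box 0 φ).eval u
  | box 1 φ => φ.eval u ∧ (box 1 φ).eval u
  | box (_ + 2) _ => True

theorem eval_truthBelow (u : Form V → Prop) (φ : Form V) :
    φ.eval (truthBelow u) ↔ truthBelow u φ := by
  induction φ with
  | var q => exact Iff.rfl
  | bot => exact Iff.rfl
  | imp φ ψ hφ hψ => simp only [eval_imp, truthBelow, hφ, hψ]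
  | box n φ _ => exact Iff.rfl

/-- Reflection at `u` is needed only for `[0]φ → [1]φ`: the new world has `u` as a `[1]`-successor,
while its `[0]φ` is that of `u`. -/
theorem truthBelow_of_GLP {u : Form V → Prop} (hu : World u)
    (hr : ∀ ψ, (reflection ψ).eval u) {φ : Form V} (h : GLP φ) : truthBelow u φ := by
  induction h with
  | taut h => exact (eval_truthBelow u _).1 (h _)
  | axK n φ ψ =>
    match n with
    | 0 => exact hu _ (axK 0 φ ψ)
    | 1 => exact fun h h' => ⟨h.1 h'.1, hu _ (axK 1 φ ψ) h.2 h'.2⟩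
    | n + 2 => exact fun _ _ => trivial
  | loeb n φ =>
    match n with
    | 0 => exact hu _ (loeb 0 φ)
    | 1 => exact fun h => ⟨h.1 (hu _ (loeb 1 φ) h.2), hu _ (loeb 1 φ) h.2⟩
    | n + 2 => exact fun _ => trivial
  | @negIntro m n φ hmn =>
    match m, n, hmn with
    | m, n + 2, _ => exact fun _ => trivial
    | 0, 1, _ =>
      intro h
      have h' : (dia 0 φ).eval u := h
      exact ⟨h', hu _ (negIntro φ zero_lt_one) h'⟩
    | m + 1, 1, hmn => omega
    | m, 0, hmn => omega
  | @mono m n φ hmn =>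
    match m, n, hmn with
    | m, n + 2, _ => exact fun _ => trivial
    | 0, 0, _ => exact id
    | 0, 1, _ => exact fun h => ⟨hr φ h, hu _ (mono φ zero_le_one) h⟩
    | 1, 1, _ => exact id
    | m + 2, 1, hmn => omega
    | m + 1, 0, hmn => omega
  | mp _ _ h h' => exact h h'
  | @nec n φ h _ =>
    match n with
    | 0 => exact hu _ (nec 0 h)
    | 1 => exact ⟨hu _ h, hu _ (nec 1 h)⟩
    | n + 2 => exact trivial

/-- If `[1]φ` is provable, then `φ` follows from finitely many instances of reflection. -/
theorem exists_followsFromReflections {φ : Form V} (h : GLP (box 1 φ)) :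
    ∃ k, FollowsFromReflections GLP k φ := by
  suffices ∃ l : List (Form V), GLP ((conj (l.map reflection)).imp φ) by
    obtain ⟨l, hl⟩ := this
    exact ⟨l.length, l, le_rfl, hl⟩
  by_contra hcon
  obtain ⟨u, hu, hn⟩ := exists_eval_not_of_not_mem
    (D := fun φ : Form V => ∃ l : List (Form V), GLP ((conj (l.map reflection)).imp φ))
    (fun φ hφ => ⟨[], taut fun v _ => hφ v⟩)
    (fun φ ψ ⟨l, hl⟩ ⟨l', hl'⟩ => ⟨l ++ l', of_world fun v hv hc => by
      simp only [eval_conj, List.map_append, List.mem_append] at hc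
      exact hv _ hl ((eval_conj _ _).2 fun χ hχ => hc χ (Or.inl hχ))
        (hv _ hl' ((eval_conj _ _).2 fun χ hχ => hc χ (Or.inr hχ)))⟩) hcon
  have hw : World u := fun χ hχ => hu χ ⟨[], of_world fun v hv _ => hv _ hχ⟩
  have hr : ∀ ψ, (reflection ψ).eval u := fun ψ => hu _ ⟨[ψ], taut fun v hv =>
    (eval_conj _ _).1 hv _ (by simp)⟩
  exact hn (truthBelow_of_GLP hw hr h).1

theorem eval_Q_of_eval {v : Form V → Prop} {φ : Form V} (h : φ.eval v) :
    ∀ i, (Q φ i).eval v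
  | 0 => h
  | 1 => h
  | _ + 2 => (eval_or _ _ _).2 (Or.inl h)

/-- Along a `[0]`-chain of worlds refuting `φ`, each world refutes reflection for a different
formula; so such a chain has at most as many members as there are instances. -/
theorem eval_Q_succ_of_reflections {φ : Form V} (n : ℕ) :
    ∀ (l : List (Form V)) (γ : Form V), l.length ≤ n → GLP (γ.imp (box 0 γ)) →
      (∀ v, World v → γ.eval v → (∀ ψ ∈ l, (reflection ψ).eval v) → φ.eval v) →
      ∀ v, World v → γ.eval v → (Q φ (n + 1)).eval v := by
  classical
  induction n with
  | zero =>
    intro l γ hl _ h v hv hγ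
    obtain rfl : l = [] := List.length_eq_zero_iff.1 (Nat.le_zero.1 hl)
    exact h v hv hγ (by simp)
  | succ n ih =>
    intro l γ hl hγγ h v hv hγ
    refine (eval_or _ _ _).2 (or_iff_not_imp_left.2 fun hφ => ?_)
    obtain ⟨ψ, hψ, hr⟩ : ∃ ψ ∈ l, ¬ (reflection ψ).eval v := by
      by_contra! hcon
      exact hφ (h v hv hγ hcon)
    rw [eval_reflection, Classical.not_imp] at hr
    -- `γ` collects what persists along the chain. Adding `ψ` makes reflection for `ψ` true from
    -- here on, so `ψ` may be erased from `l`; adding `[0]ψ` keeps `γ → [0]γ` provable.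
    have hbox : (box 0 (γ.and (ψ.and (box 0 ψ)))).eval v :=
      hv.box_and (hv _ hγγ hγ) (hv.box_and hr.1 (hv _ (box_trans 0 ψ) hr.1))
    refine hv.box_mono (ih (l.erase ψ) _ ?_ ?_ ?_) hbox
    · rw [List.length_erase_of_mem hψ]
      omega
    · refine of_world fun w hw hc => ?_
      simp only [eval_and] at hc
      exact hw.box_and (hw _ hγγ hc.1) (hw.box_and hc.2.2 (hw _ (box_trans 0 ψ) hc.2.2))
    · intro w hw hc hl'
      simp only [eval_and] at hc
      refine h w hw hc.1 fun χ hχ => ?_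
      by_cases he : χ = ψ
      · subst he
        exact fun _ => hc.2.1
      · exact hl' χ ((List.mem_erase_of_ne he).2 hχ)

/-- If `φ` fails, `Q_{i+1}` yields `[0]Q_i`, and reflection yields `Q_i`; so the valid `Q_{k+1}`
descends to `Q_1 = φ`, a contradiction. -/
theorem iff_QConj_of_followsFromReflections {φ : Form V} {k : ℕ}
    (h : FollowsFromReflections GLP k φ) : GLP (φ.iff (QConj φ k)) := by
  obtain ⟨l, hl, h⟩ := h
  refine of_world fun v hv => (eval_iff _ _ _).2 ⟨fun hφ => ?_, fun hQ => ?_⟩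
  · refine (eval_conj _ _).2 fun ψ hψ => ?_
    obtain ⟨i, -, rfl⟩ := List.mem_map.1 hψ
    exact fun _ => eval_Q_of_eval hφ i
  · by_contra hφ
    have hrefl : ∀ i, i < k → (box 0 (Q φ (i + 1))).eval v → (Q φ (i + 1)).eval v := by
      intro i hi
      refine (eval_conj _ _).1 hQ (reflection (Q φ (i + 1))) (List.mem_map.2 ⟨i + 1, ?_, rfl⟩)
      rw [List.mem_range'_1]
      omega
    have hnot : ∀ i, i ≤ k → ¬ (Q φ (i + 1)).eval v := by
      intro i
      induction i with
      | zero => exact fun _ => hφ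
      | succ i ih =>
        intro hi hQi
        rcases (eval_or _ _ _).1 hQi with h' | h'
        · exact hφ h'
        · exact ih (by omega) (hrefl i (by omega) h')
    refine hnot k le_rfl (eval_Q_succ_of_reflections k l top hl ?_ ?_ v hv fun h => h)
    · exact of_world fun w hw _ => hw _ (nec 0 (taut fun _ h => h))
    · intro w hw _ hr
      refine hw _ h ((eval_conj _ _).2 fun χ hχ => ?_)
      obtain ⟨ψ, hψ, rfl⟩ := List.mem_map.1 hχ
      exact hr ψ hψ

theorem lessGeneral_QSubst [DecidableEq V] {p : V} {k : ℕ} {σ : V → Form V}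
    (h : FollowsFromReflections GLP k (σ p)) : LessGeneral GLP σ (QSubst p k) := by
  refine ⟨σ, fun q => ?_⟩
  by_cases hq : q = p
  · subst hq
    simpa [QSubst, subst_QConj, subst] using iff_QConj_of_followsFromReflections h
  · simp only [QSubst, Function.update_of_ne hq, subst]
    exact taut fun v => (eval_iff _ _ _).2 Iff.rfl

theorem isUnifier_of_lessGeneral_QSubst [DecidableEq V] {p : V} {k : ℕ} {σ : V → Form V}
    (h : LessGeneral GLP σ (QSubst p k)) : IsUnifier GLP σ (box 1 (var p)) := by
  obtain ⟨θ, hθ⟩ := h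
  have hp := hθ p
  simp only [QSubst, Function.update_self, subst_QConj, subst] at hp
  exact of_world fun v hv => hv.box_mono
    (fun w hw h => ((eval_iff _ _ _).1 (hw _ hp)).2 h) (hv _ (box_one_QConj (θ p) k))

end GLP

theorem mainTheorem2 {V : Type*} [DecidableEq V] (p : V) :
    (∀ σ : V → Form V,
      IsUnifier GLP σ (Form.box 1 (Form.var p)) ↔
        ∃ k : ℕ, 1 ≤ k ∧ LessGeneral GLP σ (QSubst p k)) ∧
    (∀ k : ℕ, 1 ≤ k →
      IsMostGeneral GLP
        {σ : V → Form V | IsUnifier GLP σ (Form.box 1 (Form.var p)) ∧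
          FollowsFromReflections GLP k (σ p)}
        (QSubst p k)) := by
  refine ⟨fun σ => ⟨fun h => ?_, fun ⟨k, _, h⟩ => GLP.isUnifier_of_lessGeneral_QSubst h⟩,
    fun k _ => ⟨⟨?_, ?_⟩, fun τ hτ => GLP.lessGeneral_QSubst hτ.2⟩⟩
  · obtain ⟨k, l, hl, h⟩ := GLP.exists_followsFromReflections h
    -- The bound `k` may be `0`, so it is raised to meet `1 ≤ k`.
    exact ⟨k + 1, by omega, GLP.lessGeneral_QSubst ⟨l, by omega, h⟩⟩
  · simpa [IsUnifier, Form.subst, QSubst] using GLP.box_one_QConj (Form.var p) k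
  · refine ⟨(List.range' 1 k).map (Form.Q (Form.var p)), by simp, GLP.taut fun v h => ?_⟩
    simpa [QSubst, Form.QConj, Function.comp_def] using h
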